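/- Let $d\ge 3$ and $1\le k\le n$ be integers. Let $\mathcal V^{\mathrm{SU}(d)}$ denote the group of all unitaries on $(\mathbb C^d)^{\otimes n}$ that commute with $u^{\otimes n}$ for every $u\in \mathrm{SU}(d)$ (the $\mathrm{SU}(d)$-invariant unitaries on $n$ qudits). A $k$-local $\mathrm{SU}(d)$-invariant unitary is an element of $\mathcal V^{\mathrm{SU}(d)}$ that, up to a permutation of the qudits, has the form $V'\otimes \mathbb I^{\otimes (n-k)}$ with $V'$ acting on $k$ qudits; let $\mathcal V_k^{(n)}$ be the group generated by all of them. Then the $k$-local $\mathrm{SU}(d)$-invariant unitaries are universal, i.e. $\mathcal V_k^{(n)}=\mathcal V^{\mathrm{SU}(d)}$, if and only if $k=n$. Moreover, if $k<n$, then $\mathcal V_k^{(n)}\subsetneq \mathcal V_n^{(n)}$ is a proper subgroup. -/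

import Mathlib

namespace QuditCircuit

/-- Labels of the computational basis of `(ℂ^d)^{⊗n}`: one basis label of `ℂ^d` per qudit.
Operators on `(ℂ^d)^{⊗n}` are square matrices indexed by these labels. -/
abbrev Conf (d n : ℕ) : Type := Fin n → Fin d

/-- `U((ℂ^d)^{⊗n})`, the unitary group of `n` qudits. -/
abbrev UGroup (d n : ℕ) := Matrix.unitaryGroup (Conf d n) ℂ

/-- The operator `u^{⊗n}` on `(ℂ^d)^{⊗n}`. -/
def tensorPow {d : ℕ} (n : ℕ) (u : Matrix (Fin d) (Fin d) ℂ) :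
    Matrix (Conf d n) (Conf d n) ℂ :=
  Matrix.of fun x y => ∏ i, u (x i) (y i)

/-- The operator which acts as `V` on the `k` distinct qudits `e 0, …, e (k-1)` and as the identity
on the other `n - k` qudits, that is, `V ⊗ I^{⊗(n-k)}` up to a permutation of the qudits. -/
def actOn {d n k : ℕ} (e : Fin k ↪ Fin n) (V : Matrix (Conf d k) (Conf d k) ℂ) :
    Matrix (Conf d n) (Conf d n) ℂ :=
  open Classical in
  Matrix.of fun x y =>
    V (fun j => x (e j)) (fun j => y (e j)) * if ∀ i ∉ Set.range e, x i = y i then 1 else 0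

/-- The group of all `SU(d)`-invariant unitaries on `n` qudits: the unitaries commuting with
`u^{⊗n}` for every `u ∈ SU(d)`. -/
def invariantUnitaries (d n : ℕ) : Subgroup (UGroup d n) where
  carrier := {W | ∀ u ∈ Matrix.specialUnitaryGroup (Fin d) ℂ,
    Commute (W : Matrix (Conf d n) (Conf d n) ℂ) (tensorPow n u)}
  one_mem' := fun _ _ => Commute.one_left _
  mul_mem' := fun ha hb u hu => (ha u hu).mul_left (hb u hu)
  inv_mem' := by
    intro W hW u hu
    have h := hW u hu
    have h1 : ((W⁻¹ : UGroup d n) : Matrix (Conf d n) (Conf d n) ℂ) * W = 1 := by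
      rw [← Submonoid.coe_mul, inv_mul_cancel, Submonoid.coe_one]
    have h2 : (W : Matrix (Conf d n) (Conf d n) ℂ) * (W⁻¹ : UGroup d n) = 1 := by
      rw [← Submonoid.coe_mul, mul_inv_cancel, Submonoid.coe_one]
    let w : (Matrix (Conf d n) (Conf d n) ℂ)ˣ :=
      ⟨(W : Matrix (Conf d n) (Conf d n) ℂ), ((W⁻¹ : UGroup d n) : Matrix _ _ ℂ), h2, h1⟩
    exact Commute.units_inv_left (u := w) h

/-- The `k`-local `SU(d)`-invariant unitaries on `n` qudits. -/
def localInvariantUnitaries (d n k : ℕ) : Set (UGroup d n) :=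
  {W | W ∈ invariantUnitaries d n ∧ ∃ (e : Fin k ↪ Fin n) (V : UGroup d k),
    (W : Matrix (Conf d n) (Conf d n) ℂ) = actOn e V}

/-- The group `V_k^{(n)}` generated by the `k`-local `SU(d)`-invariant unitaries on `n` qudits. -/
def localGroup (d n k : ℕ) : Subgroup (UGroup d n) :=
  Subgroup.closure (localInvariantUnitaries d n k)

/-- A set of gates on `n` qudits is universal (for the symmetry `SU(d)`) if the group generated by
it is the group of all `SU(d)`-invariant unitaries. -/
def IsUniversal {d n : ℕ} (S : Set (UGroup d n)) : Prop :=
  Subgroup.closure S = invariantUnitaries d n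

end QuditCircuit

/-! For `k < n` there is a nonzero Hermitian `C`, central in the invariant algebra and
trace-orthogonal to every invariant operator that is trivial on some qudit. Start from `D = v^{⊗n}`
with `v = diag(2, -1, -1, 0, …)`: it commutes with all invariants, and since `v` is traceless it is
orthogonal to operators trivial on a qudit. Let `C` represent `X ↦ tr (D X)` on the invariant
algebra (`exists_central_of_commute`); it is nonzero because pairing `D` with the cyclic permutation
of the qudits gives `2 ^ n ± 2`.

Local gates are `exp (iH)` with `H` orthogonal to `C`, so their determinants on the eigenspaces of
`C` have logarithms whose eigenvalue-weighted sum vanishes, and products keep this property. If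
every `exp (itC)` were generated, then `t · tr (C²)` would be an integer combination of the numbers
`2πc`, with `c` an eigenvalue of `C`. These are countably many, but `t` is an arbitrary real. -/

namespace QuditCircuit

open Matrix NormedSpace
open scoped Matrix.Norms.L2Operator

/-! ### Determinants, exponentials and logarithms of matrices -/

section MatrixLemmas

variable {m : Type*} [Fintype m] [DecidableEq m]

open scoped ComplexOrder in
theorem eq_zero_of_trace_mul_conjTranspose {m : Type*} [Fintype m] {A : Matrix m m ℂ}
    (h : (A * Aᴴ).trace = 0) : A = 0 :=
  Matrix.trace_mul_conjTranspose_self_eq_zero_iff.1 h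

theorem det_exp_I_smul_of_isHermitian {K : Matrix m m ℂ} (hK : K.IsHermitian) :
    (exp (Complex.I • K)).det = Complex.exp (Complex.I * K.trace) := by
  obtain ⟨U, hU⟩ : ∃ U : (Matrix m m ℂ)ˣ,
      K = U * diagonal (fun i => (hK.eigenvalues i : ℂ)) * (↑U⁻¹ : Matrix m m ℂ) :=
    ⟨Unitary.toUnits hK.eigenvectorUnitary, hK.spectral_theorem⟩
  have hI : Complex.I • K =
      U * diagonal (fun i => Complex.I * (hK.eigenvalues i : ℂ)) * (↑U⁻¹ : Matrix m m ℂ) := by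
    conv_lhs => rw [hU]
    rw [← Matrix.smul_mul, ← Matrix.mul_smul, ← Matrix.diagonal_smul]
    rfl
  rw [hI, Matrix.exp_units_conj, Matrix.exp_diagonal, Matrix.det_units_conj, Matrix.det_diagonal,
    hK.trace_eq_sum_eigenvalues, Finset.mul_sum, Complex.exp_sum]
  refine Finset.prod_congr rfl fun i _ => ?_
  rw [Pi.coe_exp, Complex.exp_eq_exp_ℂ]
  rfl

theorem exp_I_smul_mul_add_one_sub {H P : Matrix m m ℂ} (hP : P * P = P) (hHP : Commute H P) :
    exp (Complex.I • H) * P + (1 - P) = exp (Complex.I • (H * P)) := by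
  let _ : NormedAlgebra ℚ (Matrix m m ℂ) := NormedAlgebra.restrictScalars ℚ ℂ _
  have hsplit : Complex.I • H = Complex.I • (H * P) + Complex.I • (H * (1 - P)) := by
    rw [← smul_add, ← mul_add, add_sub_cancel, mul_one]
  have hPc : P * (1 - P) = 0 := by rw [mul_sub, hP, mul_one, sub_self]
  have hcP : (1 - P) * P = 0 := by rw [sub_mul, hP, one_mul, sub_self]
  have h1 : (Complex.I • (H * P)) * (Complex.I • (H * (1 - P))) = 0 := by
    rw [Matrix.smul_mul, Matrix.mul_smul, ((Commute.one_right H).sub_right hHP).eq, mul_assoc H,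
      ← mul_assoc P, hPc]
    simp
  have h2 : (Complex.I • (H * (1 - P))) * (Complex.I • (H * P)) = 0 := by
    rw [Matrix.smul_mul, Matrix.mul_smul, hHP.eq, mul_assoc H, ← mul_assoc (1 - P), hcP]
    simp
  -- The exponent kills `P`, so `P` intertwines it with `0`, whose exponential is `1`.
  have e1 : exp (Complex.I • (H * (1 - P))) * P = P := by
    have : SemiconjBy P 0 (Complex.I • (H * (1 - P))) := by
      rw [SemiconjBy, Matrix.smul_mul, mul_assoc, hcP]; simp
    simpa [SemiconjBy, eq_comm] using this.exp_right
  have e2 : exp (Complex.I • (H * P)) * (1 - P) = 1 - P := by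
    have : SemiconjBy (1 - P) 0 (Complex.I • (H * P)) := by
      rw [SemiconjBy, Matrix.smul_mul, mul_assoc, hPc]; simp
    simpa [SemiconjBy, eq_comm] using this.exp_right
  rw [hsplit, NormedSpace.exp_add_of_commute (h1.trans h2.symm), mul_assoc, e1]
  conv_lhs => rw [← e2]
  rw [← mul_add, add_sub_cancel, mul_one]

/-- Replacing `A` by `A * P + (1 - P)` keeps its block on the range of `P` and puts the identity on
the complement, so this is the determinant of that block. -/
theorem det_exp_I_smul_compress {H P : Matrix m m ℂ} (hH : H.IsHermitian) (hPh : P.IsHermitian)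
    (hP : P * P = P) (hHP : Commute H P) :
    (exp (Complex.I • H) * P + (1 - P)).det = Complex.exp (Complex.I * (H * P).trace) := by
  rw [exp_I_smul_mul_add_one_sub hP hHP]
  refine det_exp_I_smul_of_isHermitian ?_
  rw [Matrix.IsHermitian, Matrix.conjTranspose_mul, hH.eq, hPh.eq, hHP.eq]

theorem compress_mul {A B P : Matrix m m ℂ} (hP : P * P = P) (hB : Commute B P) :
    A * B * P + (1 - P) = (A * P + (1 - P)) * (B * P + (1 - P)) := by
  have hB' := hB.eq
  have e1 : A * P * (B * P) = A * B * P := by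
    rw [mul_assoc, ← mul_assoc P, ← hB', mul_assoc B, hP, mul_assoc]
  have e2 : A * P * (1 - P) = 0 := by rw [mul_assoc, mul_sub, hP]; simp
  have hcP : (1 - P) * P = 0 := by rw [sub_mul, hP, one_mul, sub_self]
  have e3 : (1 - P) * (B * P) = 0 := by rw [hB', ← mul_assoc, hcP, zero_mul]
  have e4 : (1 - P) * (1 - P) = 1 - P := by
    rw [mul_sub, mul_one, hcP, sub_zero]
  rw [mul_add, add_mul, add_mul, e1, e2, e3, e4]
  simp

/-- A unitary matrix has a Hermitian logarithm in its double commutant. -/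
theorem exists_isHermitian_log (W : Matrix.unitaryGroup m ℂ) :
    ∃ H : Matrix m m ℂ, H.IsHermitian ∧ exp (Complex.I • H) = (W : Matrix m m ℂ) ∧
      ∀ Q, Commute (W : Matrix m m ℂ) Q → Commute H Q := by
  have hW : IsStarNormal (W : Matrix m m ℂ) := inferInstance
  -- On a finite spectrum every function is continuous, so the branch cut of `arg` is harmless.
  have hfin : (spectrum ℂ (W : Matrix m m ℂ)).Finite := Matrix.finite_spectrum _
  have hc (f : ℂ → ℂ) : ContinuousOn f (spectrum ℂ (W : Matrix m m ℂ)) := hfin.continuousOn f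
  have hs (z : ℂ) (hz : z ∈ spectrum ℂ (W : Matrix m m ℂ)) : ‖z‖ = 1 := by
    simpa using spectrum.subset_circle_of_unitary W.2 hz
  refine ⟨cfc (fun z : ℂ => (z.arg : ℂ)) (W : Matrix m m ℂ), ?_, ?_, ?_⟩
  · change star _ = _
    rw [← cfc_star]
    simp
  · rw [← cfc_smul _ _ _ (hc _), ← CFC.complex_exp_eq_normedSpace_exp (cfc_predicate _ _),
      ← cfc_comp' _ _ _ Complex.continuous_exp.continuousOn (hc _)]
    conv_rhs => rw [← cfc_id' ℂ (W : Matrix m m ℂ)]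
    refine cfc_congr fun z hz => ?_
    have := Complex.norm_mul_exp_arg_mul_I z
    rw [hs z hz] at this
    simpa [mul_comm] using this
  · intro Q hQ
    refine hQ.cfc ?_ _
    have hmem := W.2
    rw [Matrix.mem_unitaryGroup_iff] at hmem
    have h1 : star (W : Matrix m m ℂ) * W = 1 := Matrix.mem_unitaryGroup_iff'.1 W.2
    let w : (Matrix m m ℂ)ˣ := ⟨W, star (W : Matrix m m ℂ), hmem, h1⟩
    exact Commute.units_inv_left (u := w) hQ

/-! ### The determinant obstruction -/

/-- The spectral projection of a Hermitian matrix for the eigenvalue `c`. -/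
noncomputable def spectralProj (C : Matrix m m ℂ) (c : ℝ) : Matrix m m ℂ :=
  cfc (fun x : ℝ => if x = c then (1 : ℝ) else 0) C

theorem continuousOn_real_spectrum (C : Matrix m m ℂ) (f : ℝ → ℝ) :
    ContinuousOn f (spectrum ℝ C) :=
  (Matrix.finite_real_spectrum (A := C)).continuousOn f

theorem spectralProj_isHermitian (C : Matrix m m ℂ) (c : ℝ) : (spectralProj C c).IsHermitian :=
  cfc_predicate (R := ℝ) (p := IsSelfAdjoint) _ C

theorem spectralProj_mul_self (C : Matrix m m ℂ) (c : ℝ) :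
    spectralProj C c * spectralProj C c = spectralProj C c := by
  rw [spectralProj, ← cfc_mul _ _ C (continuousOn_real_spectrum C _)
    (continuousOn_real_spectrum C _)]
  congr 1
  ext x
  split_ifs <;> simp

theorem commute_spectralProj {C Q : Matrix m m ℂ} (h : Commute C Q) (c : ℝ) :
    Commute (spectralProj C c) Q :=
  h.cfc_real _

theorem sum_smul_spectralProj {C : Matrix m m ℂ} (hC : C.IsHermitian) :
    ∑ c ∈ (Matrix.finite_real_spectrum (A := C)).toFinset, c • spectralProj C c = C := by
  have hC' : IsSelfAdjoint C := hC
  conv_rhs => rw [← cfc_id' ℝ C]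
  simp only [spectralProj]
  simp_rw [← cfc_smul _ _ C (continuousOn_real_spectrum C _)]
  rw [← cfc_sum _ _ _ fun i _ => continuousOn_real_spectrum C _]
  refine cfc_congr fun x hx => ?_
  simp [Finset.sum_apply, hx]

/-- The unitary `exp (i t C)` generated by a Hermitian matrix `C`. -/
noncomputable def expUnitaryGroup {C : Matrix m m ℂ} (hC : C.IsHermitian) (t : ℝ) :
    Matrix.unitaryGroup m ℂ :=
  ⟨exp (Complex.I • ((t : ℂ) • C)), by
    let _ : NormedAlgebra ℚ (Matrix m m ℂ) := NormedAlgebra.restrictScalars ℚ ℂ _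
    refine exp_mem_unitary_of_mem_skewAdjoint ?_
    rw [skewAdjoint.mem_iff, star_smul, star_smul, Matrix.star_eq_conjTranspose, hC.eq]
    simp⟩

/-- For a generator take `v c = i tr (H P_c)`: the weighted sum is `i tr (H C) = 0`. Block
determinants are multiplicative, so logarithms add under products and change sign under inverses. -/
theorem spectral_det_eq_exp_of_mem_closure {C : Matrix m m ℂ} (hC : C.IsHermitian)
    {S : Set (Matrix.unitaryGroup m ℂ)}
    (hS : ∀ W ∈ S, ∃ H : Matrix m m ℂ, H.IsHermitian ∧
      exp (Complex.I • H) = (W : Matrix m m ℂ) ∧ Commute H C ∧ (H * C).trace = 0)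
    {W : Matrix.unitaryGroup m ℂ} (hW : W ∈ Subgroup.closure S) :
    Commute (W : Matrix m m ℂ) C ∧ ∃ v : ℝ → ℂ,
      ∑ c ∈ (Matrix.finite_real_spectrum (A := C)).toFinset, (c : ℂ) * v c = 0 ∧
      ∀ c, ((W : Matrix m m ℂ) * spectralProj C c + (1 - spectralProj C c)).det
        = Complex.exp (v c) := by
  induction hW using Subgroup.closure_induction with
  | mem W hW =>
    obtain ⟨H, hH, hexp, hHC, htr⟩ := hS W hW
    refine ⟨hexp ▸ (hHC.smul_left _).exp_left,
      fun c => Complex.I * (H * spectralProj C c).trace, ?_, fun c => ?_⟩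
    · rw [← sum_smul_spectralProj hC, Finset.mul_sum, Matrix.trace_sum] at htr
      have := congrArg (Complex.I * ·) htr
      simp only [Finset.mul_sum, mul_zero] at this
      rw [← this]
      refine Finset.sum_congr rfl fun c _ => ?_
      rw [Matrix.mul_smul, Matrix.trace_smul, Complex.real_smul, mul_left_comm]
    · rw [← hexp]
      exact det_exp_I_smul_compress hH (spectralProj_isHermitian C c) (spectralProj_mul_self C c)
        (commute_spectralProj hHC.symm c).symm
  | one =>
    exact ⟨Commute.one_left C, 0, by simp, fun c => by simp⟩
  | mul A B _ _ hA hB =>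
    obtain ⟨hAC, a, ha, ha'⟩ := hA
    obtain ⟨hBC, b, hb, hb'⟩ := hB
    refine ⟨hAC.mul_left hBC, a + b, ?_, fun c => ?_⟩
    · simp [mul_add, Finset.sum_add_distrib, ha, hb]
    · rw [Submonoid.coe_mul, compress_mul (spectralProj_mul_self C c)
        (commute_spectralProj hBC.symm c).symm, Matrix.det_mul, ha', hb', Pi.add_apply,
        Complex.exp_add]
  | inv A _ hA =>
    obtain ⟨hAC, a, ha, ha'⟩ := hA
    have h1 : ((A⁻¹ : Matrix.unitaryGroup m ℂ) : Matrix m m ℂ) * A = 1 := by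
      rw [← Submonoid.coe_mul, inv_mul_cancel, Submonoid.coe_one]
    have h2 : (A : Matrix m m ℂ) * (A⁻¹ : Matrix.unitaryGroup m ℂ) = 1 := by
      rw [← Submonoid.coe_mul, mul_inv_cancel, Submonoid.coe_one]
    have hinv : Commute ((A⁻¹ : Matrix.unitaryGroup m ℂ) : Matrix m m ℂ) C :=
      Commute.units_inv_left (u := ⟨_, _, h2, h1⟩) hAC
    refine ⟨hinv, -a, ?_, fun c => ?_⟩
    · simp [ha]
    · have := compress_mul (A := ((A⁻¹ : Matrix.unitaryGroup m ℂ) : Matrix m m ℂ)) (B := A)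
        (spectralProj_mul_self C c) (commute_spectralProj hAC.symm c).symm
      rw [h1, one_mul, add_sub_cancel] at this
      have hdet := congrArg Matrix.det this
      rw [Matrix.det_one, Matrix.det_mul, ha'] at hdet
      rw [Pi.neg_apply, Complex.exp_neg]
      exact eq_inv_of_mul_eq_one_left hdet.symm

/-- If the generators are of the form `exp (i H)` with `H` commuting with `C` and orthogonal to it,
then the one-parameter group of `C` leaves the group they generate. -/
theorem exists_expUnitaryGroup_notMem_closure {C : Matrix m m ℂ} (hC : C.IsHermitian) (hC0 : C ≠ 0)
    {S : Set (Matrix.unitaryGroup m ℂ)}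
    (hS : ∀ W ∈ S, ∃ H : Matrix m m ℂ, H.IsHermitian ∧
      exp (Complex.I • H) = (W : Matrix m m ℂ) ∧ Commute H C ∧ (H * C).trace = 0) :
    ∃ t : ℝ, expUnitaryGroup hC t ∉ Subgroup.closure S := by
  by_contra! hall
  set s := (Matrix.finite_real_spectrum (A := C)).toFinset
  have hCC : (C * C).trace ≠ 0 := by
    intro h
    exact hC0 (eq_zero_of_trace_mul_conjTranspose (by rwa [hC.eq]))
  have hsum : ∑ c ∈ s, (c : ℂ) * (C * spectralProj C c).trace = (C * C).trace := by
    conv_rhs => enter [1, 2]; rw [← sum_smul_spectralProj hC]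
    rw [Finset.mul_sum, Matrix.trace_sum]
    refine Finset.sum_congr rfl fun c _ => ?_
    rw [Matrix.mul_smul, Matrix.trace_smul, Complex.real_smul]
  -- Two logarithms of the same block determinant differ by `2πi z`; weighting by `c` and summing
  -- eliminates `v`.
  have key (t : ℝ) : ∃ z : s → ℤ,
      (t : ℂ) = (∑ c : s, ((c : ℝ) : ℂ) * (2 * Real.pi * z c)) / (C * C).trace := by
    obtain ⟨-, v, hv, hdet⟩ := spectral_det_eq_exp_of_mem_closure hC hS (hall t)
    have h (c : ℝ) : ∃ z : ℤ, Complex.I * (t * (C * spectralProj C c).trace) =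
        v c + z * (2 * Real.pi * Complex.I) := by
      have htC : ((t : ℂ) • C).IsHermitian := by
        rw [Matrix.IsHermitian, Matrix.conjTranspose_smul, hC.eq]; simp
      have h1 := det_exp_I_smul_compress htC (spectralProj_isHermitian C c)
        (spectralProj_mul_self C c) ((commute_spectralProj (Commute.refl C) c).symm.smul_left _)
      rw [Matrix.smul_mul, Matrix.trace_smul, smul_eq_mul] at h1
      exact Complex.exp_eq_exp_iff_exists_int.1 (h1.symm.trans (hdet c))
    choose z hz using h
    refine ⟨fun c => z c, ?_⟩
    rw [eq_div_iff hCC, ← hsum, Finset.mul_sum, Finset.sum_coe_sort s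
      (fun c => (c : ℂ) * (2 * Real.pi * z c))]
    have : Complex.I * ∑ c ∈ s, (t : ℂ) * ((c : ℂ) * (C * spectralProj C c).trace) =
        Complex.I * ∑ c ∈ s, (c : ℂ) * (2 * Real.pi * z c) := by
      rw [← sub_eq_zero, ← hv, Finset.mul_sum, Finset.mul_sum, ← Finset.sum_sub_distrib]
      refine Finset.sum_congr rfl fun c _ => ?_
      linear_combination (c : ℂ) * hz c
    exact mul_left_cancel₀ Complex.I_ne_zero this
  choose z hz using key
  have hinj : Function.Injective z := fun t t' htt => by
    have h := hz t
    rw [htt, ← hz t'] at h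
    exact_mod_cast h
  exact not_countable_iff.2 inferInstance hinj.countable

/-! ### Central elements from the trace form -/

/-- Riesz representation of a tracial functional on a `*`-algebra of matrices. -/
theorem exists_central_of_commute (A : StarSubalgebra ℂ (Matrix m m ℂ)) {D : Matrix m m ℂ}
    (hD : D.IsHermitian) (hDA : ∀ X ∈ A, Commute D X) :
    ∃ C ∈ A, C.IsHermitian ∧ (∀ X ∈ A, Commute C X) ∧ ∀ X ∈ A, (C * X).trace = (D * X).trace := by
  have nondeg (Y : Matrix m m ℂ) (hY : Y ∈ A) (h : ∀ X ∈ A, (Y * X).trace = 0) : Y = 0 :=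
    eq_zero_of_trace_mul_conjTranspose (h _ (star_mem hY))
  let T : A →ₗ[ℂ] Module.Dual ℂ A :=
    LinearMap.mk₂ ℂ (fun Y X : A => ((Y : Matrix m m ℂ) * (X : Matrix m m ℂ)).trace)
      (fun _ _ _ => by simp [add_mul]) (fun _ _ _ => by simp)
      (fun _ _ _ => by simp [mul_add]) (fun _ _ _ => by simp)
  have hfd : FiniteDimensional ℂ A := inferInstanceAs (FiniteDimensional ℂ A.toSubalgebra)
  have hinj : Function.Injective T := by
    rw [← LinearMap.ker_eq_bot, LinearMap.ker_eq_bot']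
    intro Y hY
    exact Subtype.ext (nondeg Y Y.2 fun X hX => LinearMap.congr_fun hY ⟨X, hX⟩)
  have hsurj : Function.Surjective T :=
    (LinearMap.injective_iff_surjective_of_finrank_eq_finrank
      (Subspace.dual_finrank_eq (K := ℂ) (V := A)).symm).1 hinj
  obtain ⟨⟨C, hCA⟩, hC⟩ := hsurj
    ((Matrix.traceLinearMap m ℂ ℂ ∘ₗ LinearMap.mulLeft ℂ D) ∘ₗ A.toSubalgebra.val.toLinearMap)
  have hC' (X : Matrix m m ℂ) (hX : X ∈ A) : (C * X).trace = (D * X).trace :=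
    LinearMap.congr_fun hC ⟨X, hX⟩
  refine ⟨C, hCA, ?_, ?_, hC'⟩
  · rw [Matrix.IsHermitian, ← sub_eq_zero]
    refine nondeg _ (sub_mem (star_mem hCA) hCA) fun X hX => ?_
    have h := congrArg star (hC' _ (star_mem hX))
    rw [← Matrix.trace_conjTranspose, ← Matrix.trace_conjTranspose, Matrix.conjTranspose_mul,
      Matrix.conjTranspose_mul, hD.eq, Matrix.star_eq_conjTranspose,
      Matrix.conjTranspose_conjTranspose, Matrix.trace_mul_comm, Matrix.trace_mul_comm X D] at h
    rw [sub_mul, Matrix.trace_sub, h, hC' X hX, sub_self]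
  · intro X hX
    refine sub_eq_zero.1 (nondeg _ (sub_mem (mul_mem hCA hX) (mul_mem hX hCA)) fun Y hY => ?_)
    have h1 := hC' _ (mul_mem hX hY)
    have h2 := hC' _ (mul_mem hY hX)
    have h3 : (X * C * Y).trace = (C * (Y * X)).trace := by
      rw [mul_assoc, Matrix.trace_mul_comm, mul_assoc]
    -- As `D` commutes with `A`, the functional `tr (D ·)` is tracial on `A`, which makes `C`
    -- central.
    have h4 : (D * (Y * X)).trace = (D * (X * Y)).trace := by
      rw [← mul_assoc, Matrix.trace_mul_comm, ← mul_assoc, ← (hDA X hX).eq, mul_assoc]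
    rw [sub_mul, Matrix.trace_sub, h3, mul_assoc, h1, h2, h4, sub_self]

end MatrixLemmas

/-! ### Invariant operators and label counts -/

theorem commute_permMatrix_iff {m : Type*} [Fintype m] [DecidableEq m] {M : Matrix m m ℂ}
    {π : Equiv.Perm m} : Commute M (π.permMatrix ℂ) ↔ M.submatrix π π = M := by
  rw [Commute, SemiconjBy, Equiv.Perm.permMatrix, PEquiv.toMatrix_toPEquiv_mul,
    PEquiv.mul_toMatrix_toPEquiv]
  constructor
  · intro h
    ext x y
    simpa using (congrFun (congrFun h x) (π y)).symm
  · intro h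
    ext x y
    simpa using (congrFun (congrFun h x) (π.symm y)).symm

variable {d n : ℕ}

theorem tensorPow_conjTranspose (u : Matrix (Fin d) (Fin d) ℂ) :
    (tensorPow n u)ᴴ = tensorPow n uᴴ := by
  ext x y
  simp [tensorPow]

theorem tensorPow_diagonal (v : Fin d → ℂ) :
    tensorPow n (diagonal v) = diagonal (fun x : Conf d n => ∏ i, v (x i)) := by
  ext x y
  rw [tensorPow, Matrix.of_apply]
  by_cases h : x = y
  · subst h; simp
  · rw [diagonal_apply_ne _ h]
    obtain ⟨i, hi⟩ := Function.ne_iff.1 h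
    exact Finset.prod_eq_zero (Finset.mem_univ i) (diagonal_apply_ne _ hi)

/-- The `*`-algebra of all `SU(d)`-invariant operators on `n` qudits. -/
noncomputable def invariantAlgebra (d n : ℕ) : StarSubalgebra ℂ (Matrix (Conf d n) (Conf d n) ℂ) :=
  StarSubalgebra.centralizer ℂ (tensorPow n '' Matrix.specialUnitaryGroup (Fin d) ℂ)

theorem star_mem_specialUnitaryGroup {u : Matrix (Fin d) (Fin d) ℂ}
    (hu : u ∈ Matrix.specialUnitaryGroup (Fin d) ℂ) :
    star u ∈ Matrix.specialUnitaryGroup (Fin d) ℂ := by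
  rw [Matrix.mem_specialUnitaryGroup_iff] at hu ⊢
  refine ⟨Unitary.star_mem hu.1, ?_⟩
  rw [Matrix.star_eq_conjTranspose, Matrix.det_conjTranspose, hu.2, star_one]

theorem mem_invariantAlgebra {M : Matrix (Conf d n) (Conf d n) ℂ} :
    M ∈ invariantAlgebra d n ↔
      ∀ u ∈ Matrix.specialUnitaryGroup (Fin d) ℂ, Commute M (tensorPow n u) := by
  rw [invariantAlgebra, StarSubalgebra.mem_centralizer_iff, Set.forall_mem_image]
  refine ⟨fun h u hu => (h hu).1.symm, fun h u hu => ⟨(h u hu).symm, ?_⟩⟩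
  rw [Matrix.star_eq_conjTranspose, tensorPow_conjTranspose]
  exact (h _ (star_mem_specialUnitaryGroup hu)).symm

/-- The diagonal element of `SU(d)` which distinguishes the basis label `b` from the others. -/
noncomputable def labelPhase (d : ℕ) (b a : Fin d) : ℂ :=
  Complex.exp (Complex.I * ((if a = b then 1 else 0) - 1 / d))

theorem diagonal_labelPhase_mem (b : Fin d) :
    diagonal (labelPhase d b) ∈ Matrix.specialUnitaryGroup (Fin d) ℂ := by
  have hd : (d : ℂ) ≠ 0 := Nat.cast_ne_zero.2 b.pos.ne'
  rw [Matrix.mem_specialUnitaryGroup_iff, Matrix.mem_unitaryGroup_iff]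
  constructor
  · rw [Matrix.star_eq_conjTranspose, Matrix.diagonal_conjTranspose, Matrix.diagonal_mul_diagonal,
      ← Matrix.diagonal_one]
    congr 1
    ext a
    simp only [labelPhase, Pi.star_apply, RCLike.star_def]
    rw [← Complex.exp_conj, ← Complex.exp_add]
    split_ifs <;> simp
  · simp only [Matrix.det_diagonal, labelPhase]
    rw [← Complex.exp_sum, ← Finset.mul_sum, Finset.sum_sub_distrib]
    simp [hd]

theorem prod_labelPhase (b : Fin d) (x : Conf d n) :
    ∏ i, labelPhase d b (x i) =
      Complex.exp (Complex.I * ((Finset.univ.filter fun i => x i = b).card - n / d)) := by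
  simp only [labelPhase]
  rw [← Complex.exp_sum, ← Finset.mul_sum, Finset.sum_sub_distrib]
  simp [div_eq_mul_inv]

/-- Because `π` is irrational, a nonzero multiple of `2π` is never an integer; hence one diagonal
element per label recovers the exact count. -/
theorem nat_eq_of_exp_I_mul_eq {a b : ℕ} {r : ℂ}
    (h : Complex.exp (Complex.I * (a - r)) = Complex.exp (Complex.I * (b - r))) : a = b := by
  obtain ⟨z, hz⟩ := Complex.exp_eq_exp_iff_exists_int.1 h
  have h1 : ((a : ℤ) - b : ℂ) = z * (2 * Real.pi) :=
    mul_left_cancel₀ Complex.I_ne_zero (by push_cast; linear_combination hz)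
  have h2 : (((a : ℤ) - b : ℤ) : ℝ) = (2 * z : ℤ) * Real.pi := by
    have : ((((a : ℤ) - b : ℤ) : ℝ) : ℂ) = (((2 * z : ℤ) * Real.pi : ℝ) : ℂ) := by
      push_cast at h1 ⊢
      linear_combination h1
    exact_mod_cast this
  rcases eq_or_ne (2 * z) 0 with h0 | h0
  · rw [h0] at h2
    rw [Int.cast_zero, zero_mul, Int.cast_eq_zero] at h2
    omega
  · exact ((irrational_pi.intCast_mul h0).ne_int ((a : ℤ) - b) h2.symm).elim

/-- Invariant operators preserve the number of occurrences of each basis label. -/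
theorem commute_diagonal_of_mem_invariantAlgebra {M : Matrix (Conf d n) (Conf d n) ℂ}
    (hM : M ∈ invariantAlgebra d n) (v : Fin d → ℂ) :
    Commute (tensorPow n (diagonal v)) M := by
  rw [tensorPow_diagonal]
  ext x y
  rw [Matrix.diagonal_mul, Matrix.mul_diagonal, mul_comm]
  rcases eq_or_ne (M x y) 0 with h0 | h0
  · simp [h0]
  congr 1
  have hcount (b : Fin d) : (Finset.univ.filter fun i => x i = b).card =
      (Finset.univ.filter fun i => y i = b).card := by
    have h := mem_invariantAlgebra.1 hM _ (diagonal_labelPhase_mem b)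
    rw [tensorPow_diagonal] at h
    have h' := congrFun (congrFun h.eq x) y
    rw [Matrix.diagonal_mul, Matrix.mul_diagonal, mul_comm] at h'
    have h'' := mul_right_cancel₀ h0 h'
    rw [prod_labelPhase, prod_labelPhase] at h''
    exact (nat_eq_of_exp_I_mul_eq h'').symm
  rw [← Finset.prod_fiberwise' Finset.univ x v, ← Finset.prod_fiberwise' Finset.univ y v]
  simp [hcount]

/-! ### Orthogonality to local operators -/

/-- Cyclic translation by `c` of the basis label of the qudit `i`. -/
def shiftLabel [NeZero d] (i : Fin n) (c : Fin d) : Equiv.Perm (Conf d n) :=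
  Equiv.addRight (Pi.single i c)

theorem shiftLabel_apply_self [NeZero d] (i : Fin n) (c : Fin d) (x : Conf d n) :
    shiftLabel i c x i = x i + c := by
  simp [shiftLabel]

theorem shiftLabel_apply_of_ne [NeZero d] {i j : Fin n} (h : j ≠ i) (c : Fin d) (x : Conf d n) :
    shiftLabel i c x j = x j := by
  simp [shiftLabel, h]

/-- Locality is recorded as a commutation relation because the logarithm of a gate inherits it. -/
theorem commute_actOn_shiftLabel [NeZero d] {k : ℕ} (e : Fin k ↪ Fin n)
    (V : Matrix (Conf d k) (Conf d k) ℂ) {i : Fin n} (hi : i ∉ Set.range e) (c : Fin d) :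
    Commute (actOn e V) ((shiftLabel i c).permMatrix ℂ) := by
  rw [commute_permMatrix_iff]
  ext x y
  have hne (j : Fin k) : e j ≠ i := fun h => hi ⟨j, h⟩
  have hiff (j : Fin n) : shiftLabel i c x j = shiftLabel i c y j ↔ x j = y j := by
    rcases eq_or_ne j i with rfl | h
    · simp [shiftLabel_apply_self]
    · simp [shiftLabel_apply_of_ne h]
  simp only [actOn, Matrix.submatrix_apply, Matrix.of_apply, hiff, shiftLabel_apply_of_ne (hne _)]

/-- Averaging over the translations of the label of `i` replaces the factor `v (x i)` by the mean of
`v`. -/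
theorem trace_tensorPow_diagonal_mul_eq_zero [NeZero d] {v : Fin d → ℂ} (hv : ∑ a, v a = 0)
    {H : Matrix (Conf d n) (Conf d n) ℂ} {i : Fin n}
    (hH : ∀ c, Commute H ((shiftLabel i c).permMatrix ℂ)) :
    (tensorPow n (diagonal v) * H).trace = 0 := by
  have hdiag (c : Fin d) (x : Conf d n) : H (shiftLabel i c x) (shiftLabel i c x) = H x x :=
    congrFun (congrFun (commute_permMatrix_iff.1 (hH c)) x) x
  have hshift (c : Fin d) : (tensorPow n (diagonal v) * H).trace =
      ∑ x : Conf d n, v (x i + c) * ((∏ j ∈ Finset.univ.erase i, v (x j)) * H x x) := by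
    rw [tensorPow_diagonal, Matrix.trace, ← Equiv.sum_comp (shiftLabel i c)]
    refine Finset.sum_congr rfl fun x _ => ?_
    rw [Matrix.diag_apply, Matrix.diagonal_mul, hdiag,
      ← Finset.mul_prod_erase _ _ (Finset.mem_univ i), shiftLabel_apply_self, mul_assoc]
    congr 2
    exact Finset.prod_congr rfl fun j hj => by
      rw [shiftLabel_apply_of_ne (Finset.ne_of_mem_erase hj)]
  have hsum : (d : ℂ) * (tensorPow n (diagonal v) * H).trace = 0 := by
    calc (d : ℂ) * (tensorPow n (diagonal v) * H).trace
        = ∑ _c : Fin d, (tensorPow n (diagonal v) * H).trace := by simp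
      _ = ∑ c : Fin d, ∑ x : Conf d n,
            v (x i + c) * ((∏ j ∈ Finset.univ.erase i, v (x j)) * H x x) :=
          Finset.sum_congr rfl fun c _ => hshift c
      _ = 0 := by
          rw [Finset.sum_comm]
          refine Finset.sum_eq_zero fun x _ => ?_
          have hrow : ∑ c, v (x i + c) = 0 := (Equiv.sum_comp (Equiv.addLeft (x i)) v).trans hv
          rw [← Finset.sum_mul, hrow, zero_mul]
  exact (mul_eq_zero.1 hsum).resolve_left (Nat.cast_ne_zero.2 (NeZero.ne d))

/-! ### Nonvanishing of the central element -/

/-- The cyclic permutation of the qudits. -/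
def cyclePerm (d n : ℕ) : Equiv.Perm (Conf d n) :=
  (finRotate n).arrowCongr (Equiv.refl (Fin d))

theorem cyclePerm_apply (x : Conf d n) (i : Fin n) :
    cyclePerm d n x i = x ((finRotate n).symm i) := rfl

theorem permMatrix_cyclePerm_mem : (cyclePerm d n).permMatrix ℂ ∈ invariantAlgebra d n := by
  refine mem_invariantAlgebra.2 fun u _ => Commute.symm (commute_permMatrix_iff.2 ?_)
  ext x y
  simp only [tensorPow, Matrix.submatrix_apply, Matrix.of_apply, cyclePerm_apply]
  exact Equiv.prod_comp (finRotate n).symm fun i => u (x i) (y i)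

theorem cyclePerm_eq_self_iff (hn : n ≠ 0) {x : Conf d n} :
    cyclePerm d n x = x ↔ ∃ a, Function.const (Fin n) a = x := by
  constructor
  · intro h
    obtain ⟨m, rfl⟩ := Nat.exists_eq_succ_of_ne_zero hn
    refine ⟨x 0, funext fun i => ?_⟩
    induction i using Fin.induction with
    | zero => rfl
    | succ i ih =>
      rw [Function.const_apply] at ih ⊢
      rw [ih, ← congrFun h i.succ, cyclePerm_apply]
      congr 1
      rw [Equiv.eq_symm_apply, finRotate_apply, Fin.coeSucc_eq_succ]
  · rintro ⟨a, rfl⟩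
    rfl

/-- Only constant configurations are fixed by the cycle. -/
theorem trace_tensorPow_diagonal_mul_cyclePerm (hn : n ≠ 0) (v : Fin d → ℂ) :
    (tensorPow n (diagonal v) * (cyclePerm d n).permMatrix ℂ).trace = ∑ a, v a ^ n := by
  have : Nonempty (Fin n) := ⟨⟨0, Nat.pos_of_ne_zero hn⟩⟩
  rw [tensorPow_diagonal, Matrix.trace, eq_comm]
  refine Fintype.sum_of_injective (Function.const (Fin n)) Function.const_injective _ _ ?_ ?_
  · intro x hx
    have : cyclePerm d n x ≠ x := fun h => hx ((cyclePerm_eq_self_iff hn).1 h)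
    simp [Equiv.Perm.permMatrix, PEquiv.toMatrix_apply, this]
  · intro a
    have : cyclePerm d n (Function.const (Fin n) a) = Function.const (Fin n) a :=
      (cyclePerm_eq_self_iff hn).2 ⟨a, rfl⟩
    simp [Equiv.Perm.permMatrix, PEquiv.toMatrix_apply, this]

/-- The spectrum `(2, -1, -1, 0, …, 0)` of a traceless operator on a qudit. -/
def tracelessWeight (d : ℕ) (a : Fin d) : ℝ :=
  if a.val = 0 then 2 else if a.val ≤ 2 then -1 else 0

theorem sum_tracelessWeight_pow (hd : 3 ≤ d) (hn : n ≠ 0) :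
    ∑ a, tracelessWeight d a ^ n = 2 ^ n + 2 * (-1) ^ n := by
  obtain ⟨d, rfl⟩ := Nat.exists_eq_add_of_le' hd
  simp [Fin.sum_univ_succ, tracelessWeight, hn]
  ring

theorem sum_tracelessWeight (hd : 3 ≤ d) : ∑ a, tracelessWeight d a = 0 := by
  simpa using sum_tracelessWeight_pow hd one_ne_zero

/-- Three labels are needed: on two, a traceless `(a, -a)` has vanishing odd power sums. -/
theorem sum_tracelessWeight_pow_ne_zero (hd : 3 ≤ d) (hn : 2 ≤ n) :
    ∑ a, tracelessWeight d a ^ n ≠ 0 := by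
  rw [sum_tracelessWeight_pow hd (by omega)]
  have h4 : (2 : ℝ) ^ 2 ≤ 2 ^ n := pow_le_pow_right₀ (by norm_num) hn
  rcases neg_one_pow_eq_or ℝ n with h | h <;> rw [h] <;> linarith

/-- A nonzero central invariant operator orthogonal to all invariant operators which commute with
the label translations of some qudit. -/
theorem exists_central_orthogonal [NeZero d] (hd : 3 ≤ d) (hn : 2 ≤ n) :
    ∃ C ∈ invariantAlgebra d n, C.IsHermitian ∧ C ≠ 0 ∧
      (∀ X ∈ invariantAlgebra d n, Commute C X) ∧
      ∀ X ∈ invariantAlgebra d n,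
        ∀ i, (∀ c, Commute X ((shiftLabel i c).permMatrix ℂ)) → (C * X).trace = 0 := by
  let v : Fin d → ℂ := fun a => tracelessWeight d a
  have hv : ∑ a, v a = 0 := by
    simp only [v]
    exact_mod_cast sum_tracelessWeight hd
  have hvn : ∑ a, v a ^ n ≠ 0 := by
    simp only [v]
    exact_mod_cast sum_tracelessWeight_pow_ne_zero hd hn
  have hD : (tensorPow n (diagonal v)).IsHermitian := by
    rw [Matrix.IsHermitian, tensorPow_conjTranspose, Matrix.diagonal_conjTranspose]
    congr 2
    ext a
    simp [v]
  obtain ⟨C, hCA, hC, hcomm, htr⟩ := exists_central_of_commute (invariantAlgebra d n) hD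
    fun X hX => commute_diagonal_of_mem_invariantAlgebra hX v
  refine ⟨C, hCA, hC, ?_, hcomm, fun X hX i hi => ?_⟩
  · rintro rfl
    have := htr _ permMatrix_cyclePerm_mem
    rw [trace_tensorPow_diagonal_mul_cyclePerm (by omega), zero_mul, Matrix.trace_zero] at this
    exact hvn this.symm
  · rw [htr X hX, trace_tensorPow_diagonal_mul_eq_zero hv hi]

/-! ### Proper inclusion of the local groups -/

theorem localInvariantUnitaries_self (d n : ℕ) :
    localInvariantUnitaries d n n = invariantUnitaries d n := by
  ext W
  refine ⟨fun h => h.1, fun h => ⟨h, Function.Embedding.refl _, W, ?_⟩⟩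
  ext x y
  simp [actOn]

theorem localGroup_self (d n : ℕ) : localGroup d n n = invariantUnitaries d n := by
  rw [localGroup, localInvariantUnitaries_self, Subgroup.closure_eq]

theorem localGroup_le (d n k : ℕ) : localGroup d n k ≤ invariantUnitaries d n :=
  (Subgroup.closure_le _).2 fun _ hW => hW.1

theorem localGroup_lt_invariantUnitaries {k : ℕ} (hd : 3 ≤ d) (hk : 1 ≤ k) (hkn : k < n) :
    localGroup d n k < invariantUnitaries d n := by
  have : NeZero d := ⟨by omega⟩
  obtain ⟨C, hCA, hC, hC0, hcomm, horth⟩ := exists_central_orthogonal (d := d) (n := n) hd (by omega)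
  obtain ⟨t, ht⟩ := exists_expUnitaryGroup_notMem_closure hC hC0
    (S := localInvariantUnitaries d n k) <| by
    rintro W ⟨hW, e, V, hV⟩
    obtain ⟨H, hH, hexp, hlog⟩ := exists_isHermitian_log W
    -- As `k < n`, the gate misses a qudit.
    obtain ⟨i, hi⟩ : ∃ i, i ∉ Set.range e := by
      by_contra! h
      have := Fintype.card_le_of_surjective e h
      simp only [Fintype.card_fin] at this
      omega
    have hHA : H ∈ invariantAlgebra d n :=
      mem_invariantAlgebra.2 fun u hu => hlog _ (hW u hu)
    refine ⟨H, hH, hexp, (hcomm H hHA).symm, ?_⟩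
    rw [Matrix.trace_mul_comm]
    exact horth H hHA i fun c => hlog _ (hV ▸ commute_actOn_shiftLabel e _ hi c)
  refine lt_of_le_of_ne (localGroup_le d n k) fun h => ht ?_
  change _ ∈ localGroup d n k
  rw [h]
  exact fun u hu => (((mem_invariantAlgebra.1 hCA u hu).smul_left _).smul_left _).exp_left

end QuditCircuit

theorem mainTheorem7 (d n k : ℕ) (hd : 3 ≤ d) (hk : 1 ≤ k) (hkn : k ≤ n) :
    (QuditCircuit.IsUniversal (QuditCircuit.localInvariantUnitaries d n k) ↔ k = n) ∧
      (k < n → QuditCircuit.localGroup d n k < QuditCircuit.localGroup d n n) := by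
  refine ⟨⟨fun h => ?_, ?_⟩, fun h => ?_⟩
  · by_contra hne
    exact (QuditCircuit.localGroup_lt_invariantUnitaries hd hk (lt_of_le_of_ne hkn hne)).ne h
  · rintro rfl
    exact QuditCircuit.localGroup_self d k
  · rw [QuditCircuit.localGroup_self]
    exact QuditCircuit.localGroup_lt_invariantUnitaries hd hk h
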